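/- Let $\varepsilon,\delta>0$ and $n,B,c\in\mathbb N$. For a finite simple undirected graph $G$ on $n$ labelled vertices let $A$ be its adjacency matrix, $c_3(G)$ its number of triangles, and $\rho(A^3)=\sum_i|\lambda_i|/\operatorname{trace}(A^3)$, where the $\lambda_i$ are the eigenvalues of $A^3$ with multiplicity. Random feature propagation (RFP) is run on $G$ with the following hyperparameters: propagation operator $A$; $B$ trajectories with one feature channel; independent Rademacher ($\pm1$ with probability $\tfrac12$ each) entries of the initial vectors $r_1,\dots,r_B\in\mathbb R^n$; any number $P\ge 2$ of propagation steps; and any normalization function $N$, applied at every $w$-th step, where $w\ge 3$. That is, $a_b^{(0)}=r_b$, and $a_b^{(p)}=N(Aa_b^{(p-1)})$ if $w\mid p$, $a_b^{(p)}=Aa_b^{(p-1)}$ otherwise; the $b$-th trajectory is $t_b=(a_b^{(0)},\dots,a_b^{(P)})$. The trajectories, together with input node features $f\in\mathbb R^{n\times c}$, are embedded nodewise by a linear layer and processed by one of the following two networks, whose depths and hidden widths are also hyperparameters ($\sigma$ is ReLU, applied entrywise; $\psi$ and $\phi$ are ReLU multi-layer perceptrons). (i) GraphConv: $x^{(0)}_v=K(f_v\oplus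 t_{1,v}\oplus\dots\oplus t_{B,v})$, layers $x_v\mapsto\sigma\big(W_1x_v+\sum_{u\sim v}W_2x_u+\beta\big)$, output $y_G=\psi\big(\sum_v x_v^{(T)}\big)$. (ii) DSS-GNN: $x^{b,(0)}_v=K(f_v\oplus t_{b,v})$, layers $x^k_v\mapsto\sigma\big(W_{11}x^k_v+W_{12}\sum_{u\sim v}x^k_u+W_{21}\sum_{b}x^b_v+W_{22}\sum_{u\sim v}\sum_b x^b_u+\beta\big)$, output $y_G=\psi\big(\sum_{b}\phi(\sum_v x^{b,(T)}_v)\big)$. Then for each of the two networks there is a choice of depth, widths and weights such that, for all input node features $f\in\mathbb R^{n\times c}$ and every graph $G$ on $n$ vertices with at least one triangle for which $$B\ \ge\ 6\,\varepsilon^{-2}\,\rho(A^3)^2\,\ln\!\big(2\operatorname{rank}(A^3)/\delta\big),$$ the output $y_G$ is an $(\varepsilon,\delta)$ relative approximation of the triangle count: $$\Pr\big(|y_G-c_3(G)|\le\varepsilon\,c_3(G)\big)\ \ge\ 1-\delta .$$ -/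

import Mathlib

open scoped Matrix

noncomputable section

namespace RFP

/-! Random feature propagation -/

/-- The features `a^(p)`: start from `r`, multiply by the propagation operator `S` at every step, and
apply the normalization function `N` at every step whose index is divisible by `w`. -/
def propagate {n k : ℕ} (S : Matrix (Fin n) (Fin n) ℝ)
    (N : Matrix (Fin n) (Fin k) ℝ → Matrix (Fin n) (Fin k) ℝ) (w : ℕ)
    (r : Matrix (Fin n) (Fin k) ℝ) : ℕ → Matrix (Fin n) (Fin k) ℝ
  | 0 => r
  | p + 1 => if (p + 1) % w = 0 then N (S * propagate S N w r p) else S * propagate S N w r p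

/-- The trajectory `r ⊕ a^(1) ⊕ ⋯ ⊕ a^(P)`; a channel is a pair (step, feature channel). -/
def trajectory {n k : ℕ} (S : Matrix (Fin n) (Fin n) ℝ)
    (N : Matrix (Fin n) (Fin k) ℝ → Matrix (Fin n) (Fin k) ℝ) (w P : ℕ)
    (r : Matrix (Fin n) (Fin k) ℝ) : Matrix (Fin n) (Fin (P + 1) × Fin k) ℝ :=
  Matrix.of fun v c => propagate S N w r c.1 v c.2

/-! Neural network components -/

/-- The ReLU non-linearity, entrywise. -/
def relu {d : ℕ} (x : Fin d → ℝ) : Fin d → ℝ := fun i => max (x i) 0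

/-- Weights of a multi-layer perceptron `ℝ^a → ℝ^b` of any depth and any hidden widths. -/
inductive MLP : ℕ → ℕ → Type
  | linear {a b : ℕ} (W : Matrix (Fin b) (Fin a) ℝ) (β : Fin b → ℝ) : MLP a b
  | layer {a b c : ℕ} (W : Matrix (Fin b) (Fin a) ℝ) (β : Fin b → ℝ) (rest : MLP b c) : MLP a c

/-- Evaluation of an MLP: dense layers with ReLU between consecutive layers. -/
def MLP.eval : {a b : ℕ} → MLP a b → (Fin a → ℝ) → (Fin b → ℝ)
  | _, _, .linear W β, x => W *ᵥ x + β
  | _, _, .layer W β rest, x => rest.eval (relu (W *ᵥ x + β))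

/-- Weights of a stack of GraphConv layers from `a` to `b` channels. -/
inductive GraphConvStack : ℕ → ℕ → Type
  | nil (a : ℕ) : GraphConvStack a a
  | cons {a b c : ℕ} (W₁ W₂ : Matrix (Fin b) (Fin a) ℝ) (β : Fin b → ℝ)
      (rest : GraphConvStack b c) : GraphConvStack a c

/-- Layers `x_v ↦ ReLU (W₁ x_v + ∑_{u ∼ v} W₂ x_u + β)`, composed. -/
def GraphConvStack.eval {n : ℕ} (G : SimpleGraph (Fin n)) [DecidableRel G.Adj] :
    {a b : ℕ} → GraphConvStack a b → (Fin n → Fin a → ℝ) → (Fin n → Fin b → ℝ)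
  | _, _, .nil _, x => x
  | _, _, .cons W₁ W₂ β rest, x =>
      rest.eval G fun v => relu (W₁ *ᵥ x v + ∑ u ∈ G.neighborFinset v, W₂ *ᵥ x u + β)

/-- Weights of a stack of DSS-GNN layers from `a` to `b` channels. -/
inductive DSSStack : ℕ → ℕ → Type
  | nil (a : ℕ) : DSSStack a a
  | cons {a b c : ℕ} (W₁₁ W₁₂ W₂₁ W₂₂ : Matrix (Fin b) (Fin a) ℝ) (β : Fin b → ℝ)
      (rest : DSSStack b c) : DSSStack a c

/-- DSS-GNN layers on a bag of `B` copies of `G`, composed. One layer is the sum of a GraphConv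
layer (weights `W₁₁`, `W₁₂`) applied to each copy, and one (weights `W₂₁`, `W₂₂`) applied to
the sum of the features over all copies, followed by ReLU. -/
def DSSStack.eval {n B : ℕ} (G : SimpleGraph (Fin n)) [DecidableRel G.Adj] :
    {a b : ℕ} → DSSStack a b → (Fin B → Fin n → Fin a → ℝ) → (Fin B → Fin n → Fin b → ℝ)
  | _, _, .nil _, x => x
  | _, _, .cons W₁₁ W₁₂ W₂₁ W₂₂ β rest, x =>
      rest.eval G fun k v => relu (W₁₁ *ᵥ x k v + W₁₂ *ᵥ (∑ u ∈ G.neighborFinset v, x k u)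
        + W₂₁ *ᵥ (∑ b, x b v) + W₂₂ *ᵥ (∑ u ∈ G.neighborFinset v, ∑ b, x b u) + β)

/-! The complete pipelines -/

/-- Weights (with depth and hidden widths) of RFP with a GraphConv downstream network, for `c`
input channels and `B` trajectories of `P` steps with `k` channels each. -/
structure GraphConvWeights (c B P k : ℕ) where
  embedDim : ℕ
  outDim : ℕ
  embed : Matrix (Fin embedDim) (Fin c ⊕ (Fin B × Fin (P + 1) × Fin k)) ℝ
  stack : GraphConvStack embedDim outDim
  readout : MLP outDim 1

/-- The output of RFP with a GraphConv downstream network: all trajectories and the input features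
are concatenated, linearly embedded, processed by the GraphConv layers, summed over the nodes and
mapped to a number by an MLP. -/
def GraphConvWeights.output {n c B P k : ℕ} (W : GraphConvWeights c B P k)
    (G : SimpleGraph (Fin n)) [DecidableRel G.Adj] (S : Matrix (Fin n) (Fin n) ℝ)
    (N : Matrix (Fin n) (Fin k) ℝ → Matrix (Fin n) (Fin k) ℝ) (w : ℕ)
    (fin : Matrix (Fin n) (Fin c) ℝ) (r : Fin B → Matrix (Fin n) (Fin k) ℝ) : ℝ :=
  let f₀ : Fin n → Fin W.embedDim → ℝ := fun v =>
    W.embed *ᵥ Sum.elim (fin v) (fun q => trajectory S N w P (r q.1) v q.2)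
  W.readout.eval (∑ v, W.stack.eval G f₀ v) 0

/-- Weights (with depth and hidden widths) of RFP with a DSS-GNN downstream network, for `c`
input channels and trajectories of `P` steps with `k` channels each. -/
structure DSSWeights (c P k : ℕ) where
  embedDim : ℕ
  outDim : ℕ
  subDim : ℕ
  embed : Matrix (Fin embedDim) (Fin c ⊕ (Fin (P + 1) × Fin k)) ℝ
  stack : DSSStack embedDim outDim
  subReadout : MLP outDim subDim
  readout : MLP subDim 1

/-- The output of RFP with a DSS-GNN downstream network: each trajectory, together with the input
features, is embedded by the same linear layer; the resulting bag of `B` graphs is processed by the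
DSS-GNN layers, each graph is read out by an MLP of the sum over its nodes, and the final readout is
an MLP of the sum over the bag. -/
def DSSWeights.output {n c B P k : ℕ} (W : DSSWeights c P k)
    (G : SimpleGraph (Fin n)) [DecidableRel G.Adj] (S : Matrix (Fin n) (Fin n) ℝ)
    (N : Matrix (Fin n) (Fin k) ℝ → Matrix (Fin n) (Fin k) ℝ) (w : ℕ)
    (fin : Matrix (Fin n) (Fin c) ℝ) (r : Fin B → Matrix (Fin n) (Fin k) ℝ) : ℝ :=
  let f₀ : Fin B → Fin n → Fin W.embedDim → ℝ := fun b v =>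
    W.embed *ᵥ Sum.elim (fin v) (fun q => trajectory S N w P (r b) v q)
  let x : Fin B → Fin W.subDim → ℝ := fun b => W.subReadout.eval (∑ v, W.stack.eval G f₀ b v)
  W.readout.eval (∑ b, x b) 0

/-! Random initialization -/

/-- The Rademacher distribution: `1` and `-1` with probability one half each. -/
def rademacher : MeasureTheory.Measure ℝ :=
  (2⁻¹ : ENNReal) • (MeasureTheory.Measure.dirac 1 + MeasureTheory.Measure.dirac (-1))

instance : MeasureTheory.IsProbabilityMeasure rademacher :=
  ⟨by simp [rademacher, ENNReal.inv_two_add_inv_two]⟩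

/-- The joint law of `B` random feature matrices of size `n × k` all of whose entries are
independent Rademacher variables; the entry `(v, c)` of the `b`-th matrix has index `(b, v, c)`. -/
def initLaw (B n k : ℕ) : MeasureTheory.Measure (Fin B × Fin n × Fin k → ℝ) :=
  MeasureTheory.Measure.pi fun _ => rademacher

/-- The `B` random feature matrices encoded by a sample point. -/
def features {B n k : ℕ} (ω : Fin B × Fin n × Fin k → ℝ) : Fin B → Matrix (Fin n) (Fin k) ℝ :=
  fun b => Matrix.of fun v c => ω (b, v, c)

/-! The quantities in the bound -/

/-- `(∑ |λ_i|) / trace C`, the sum being over the eigenvalues of the symmetric matrix `C` with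
multiplicity. -/
def rho {n : ℕ} {C : Matrix (Fin n) (Fin n) ℝ} (hC : C.IsHermitian) : ℝ :=
  (∑ i, |hC.eigenvalues i|) / C.trace

theorem isHermitian_adjMatrix_cube {n : ℕ} (G : SimpleGraph (Fin n)) [DecidableRel G.Adj] :
    (G.adjMatrix ℝ ^ 3).IsHermitian :=
  (G.isHermitian_adjMatrix ℝ).pow 3

/-- The number of triangles. -/
def triangleCount {n : ℕ} (G : SimpleGraph (Fin n)) [DecidableRel G.Adj] : ℕ :=
  (G.cliqueFinset 3).card

/-- `6 ε⁻² ρ(A³)² ln (2 rank(A³) / δ)` for the adjacency matrix `A` of `G`. -/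
def trajectoryBound {n : ℕ} (G : SimpleGraph (Fin n)) [DecidableRel G.Adj] (ε δ : ℝ) : ℝ :=
  6 * (ε ^ 2)⁻¹ * rho (isHermitian_adjMatrix_cube G) ^ 2 *
    Real.log (2 * ((G.adjMatrix ℝ ^ 3).rank : ℝ) / δ)

end RFP

end

/-! For a sign vector `s`, `s ⬝ᵥ A ^ 3 *ᵥ s = (A s) ⬝ᵥ (A ^ 2 s)` is an unbiased estimator of `trace
(A ^ 3)`, which is six times the triangle count. Steps 1 and 2 of a trajectory are `A s` and `A ^ 2
s`, unnormalized because `w ≥ 3`. Their entries are integers bounded by `n` and `n * n`, so one ReLU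
layer multiplies them exactly (`int_mul_eq_sum_relu`), and sum pooling with a linear readout yields
the scaled mean of the `B` quadratic forms (`sum_productUnit_eq_quadratic_form`). No message passing
is needed.

Concentration: in an eigenbasis the form is `∑ λ_i X_i ^ 2`, where each `X_i` is a normalized
Rademacher sum and the `X_i` are dependent. Jensen's inequality with weights `|λ_i| / ∑ |λ_j|`
reduces its exponential moment to those of `±(X_i ^ 2 - 1)`, so independence across eigenvectors is
never used (`sum_exp_quadratic_form_le`). The plus sign is bounded by Gaussian comparison, the minus
sign by the fourth moment. With `τ = 1 / ρ` and `θ = 3/10 * ε * τ`, Chernoff's method bounds each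
tail by `exp (-B (ε / ρ) ^ 2 / 6)` (`card_mean_error_le`). There is no union bound over eigenvalues;
the rank enters only through being at least 1.

For `ε` near 1 the plain estimator's upper tail bound is too weak, so the estimate is divided by
`21/20`. For `ε ≥ 1` the zero network suffices. -/

open MeasureTheory

/-! ### Probabilities as counts of sign vectors -/

/-- The real sign `±1` encoded by a Boolean. -/
def boolSign (b : Bool) : ℝ := if b then 1 else -1

theorem pi_rademacher {ι : Type*} [Fintype ι] [DecidableEq ι] :
    Measure.pi (fun _ : ι => RFP.rademacher) =
      ∑ s : ι → Bool, ((2⁻¹ : ENNReal) ^ Fintype.card ι) • Measure.dirac (fun i => boolSign (s i)) := by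
  refine Measure.pi_eq fun A hA => ?_
  have h : ∀ i, RFP.rademacher (A i)
      = ∑ b : Bool, 2⁻¹ * (A i).indicator (1 : ℝ → ENNReal) (boolSign b) := by
    intro i
    simp [RFP.rademacher, boolSign, Measure.dirac_apply' _ (hA i)]
  simp_rw [h]
  rw [Fintype.prod_sum, Measure.finsetSum_apply]
  refine Finset.sum_congr rfl fun s _ => ?_
  rw [Finset.prod_mul_distrib, Measure.smul_apply, Measure.dirac_apply' _ (MeasurableSet.univ_pi hA)]
  simp only [Finset.prod_const, Finset.card_univ, smul_eq_mul]
  congr 1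
  by_cases hs : ∀ i, boolSign (s i) ∈ A i
  · rw [Set.indicator_of_mem (by simpa using hs)]
    symm
    exact Finset.prod_eq_one fun i _ => by rw [Set.indicator_of_mem (hs i)]; rfl
  · rw [Set.indicator_of_notMem (by simpa using hs)]
    push Not at hs
    obtain ⟨i, hi⟩ := hs
    symm
    exact Finset.prod_eq_zero (Finset.mem_univ i) (Set.indicator_of_notMem hi _)

open Classical in
theorem initLaw_real (B n k : ℕ) (S : Set (Fin B × Fin n × Fin k → ℝ)) :
    (RFP.initLaw B n k).real S =
      ∑ s : Fin B × Fin n × Fin k → Bool,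
        (1 / 2 : ℝ) ^ Fintype.card (Fin B × Fin n × Fin k) *
          if (fun i => boolSign (s i)) ∈ S then 1 else 0 := by
  rw [Measure.real, RFP.initLaw, pi_rademacher, Measure.finsetSum_apply, ENNReal.toReal_sum]
  · refine Finset.sum_congr rfl fun s _ => ?_
    rw [Measure.smul_apply, Measure.dirac_apply, smul_eq_mul, ENNReal.toReal_mul,
      ENNReal.toReal_pow]
    simp [Set.indicator_apply]
    split_ifs <;> simp
  · intro s _
    rw [Measure.smul_apply, smul_eq_mul]
    exact ENNReal.mul_ne_top (by simp) (measure_ne_top _ _)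

/-! ### Moments of Rademacher sums -/

/-- The inner product of a real vector with a vector of signs. -/
def signSum {ι : Type*} [Fintype ι] (u : ι → ℝ) (s : ι → Bool) : ℝ := ∑ i, u i * boolSign (s i)

theorem sum_bool_fin_succ {n : ℕ} (f : (Fin (n + 1) → Bool) → ℝ) :
    ∑ s, f s = ∑ s : Fin n → Bool, (f (Fin.cons true s) + f (Fin.cons false s)) := by
  rw [← (Fin.consEquiv fun _ : Fin (n + 1) => Bool).sum_comp, Fintype.sum_prod_type,
    Fintype.sum_bool, ← Finset.sum_add_distrib]
  rfl

theorem signSum_cons {n : ℕ} (u : Fin (n + 1) → ℝ) (b : Bool) (s : Fin n → Bool) :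
    signSum u (Fin.cons b s) = u 0 * boolSign b + signSum (Fin.tail u) s := by
  simp [signSum, Fin.sum_univ_succ, Fin.tail]

theorem sum_signSum_sq {n : ℕ} (u : Fin n → ℝ) :
    ∑ s, signSum u s ^ 2 = 2 ^ n * ∑ i, u i ^ 2 := by
  induction n with
  | zero => simp [signSum]
  | succ n ih =>
    have h : ∀ s : Fin n → Bool, signSum u (Fin.cons true s) ^ 2 + signSum u (Fin.cons false s) ^ 2
        = 2 * u 0 ^ 2 + 2 * signSum (Fin.tail u) s ^ 2 := by
      intro s
      simp only [signSum_cons, boolSign]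
      simp
      ring
    rw [sum_bool_fin_succ, Finset.sum_congr rfl fun s _ => h s, Finset.sum_add_distrib,
      ← Finset.mul_sum (f := fun s => signSum (Fin.tail u) s ^ 2), ih,
      Fin.sum_univ_succ]
    simp [Fin.tail]
    ring

/-- Averaging over the first sign cancels odd powers, and the cross term `6 * u 0 ^ 2 * X ^ 2` is
exactly that of `3 * (∑ u i ^ 2) ^ 2`; only the pure fourth powers leave slack. -/
theorem sum_signSum_pow_four_le {n : ℕ} (u : Fin n → ℝ) :
    ∑ s, signSum u s ^ 4 ≤ 2 ^ n * (3 * (∑ i, u i ^ 2) ^ 2) := by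
  induction n with
  | zero => simp [signSum]
  | succ n ih =>
    have h : ∀ s : Fin n → Bool, signSum u (Fin.cons true s) ^ 4 + signSum u (Fin.cons false s) ^ 4
        = 2 * u 0 ^ 4 + 12 * u 0 ^ 2 * signSum (Fin.tail u) s ^ 2
          + 2 * signSum (Fin.tail u) s ^ 4 := by
      intro s
      simp only [signSum_cons, boolSign]
      simp
      ring
    rw [sum_bool_fin_succ, Finset.sum_congr rfl fun s _ => h s, Finset.sum_add_distrib,
      Finset.sum_add_distrib, ← Finset.mul_sum (f := fun s => signSum (Fin.tail u) s ^ 2),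
      ← Finset.mul_sum (f := fun s => signSum (Fin.tail u) s ^ 4), sum_signSum_sq,
      Fin.sum_univ_succ]
    have := ih (Fin.tail u)
    simp only [Finset.sum_const, Finset.card_univ, Fintype.card_fun, Fintype.card_bool,
      Fintype.card_fin, nsmul_eq_mul, Nat.cast_pow, Nat.cast_ofNat]
    simp only [Fin.tail] at this ⊢
    have h2 : (0 : ℝ) ≤ 2 ^ n * u 0 ^ 4 := by positivity
    rw [pow_succ 2 n]
    nlinarith [this, h2]

/-- The sum factors over the coordinates, and each factor is controlled by `cosh x ≤ exp (x ^ 2 /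
2)`. -/
theorem sum_exp_signSum_le {n : ℕ} (u : Fin n → ℝ) (c : ℝ) :
    ∑ s, Real.exp (c * signSum u s) ≤ 2 ^ n * Real.exp (c ^ 2 / 2 * ∑ i, u i ^ 2) := by
  have h : ∀ s, Real.exp (c * signSum u s) = ∏ i, Real.exp (c * u i * boolSign (s i)) := by
    intro s
    rw [← Real.exp_sum, signSum, Finset.mul_sum]
    congr 1
    exact Finset.sum_congr rfl fun i _ => by ring
  rw [Finset.sum_congr rfl fun s _ => h s,
    ← Fintype.prod_sum fun i b => Real.exp (c * u i * boolSign b)]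
  have h2 : ∀ i, ∑ b, Real.exp (c * u i * boolSign b) ≤ 2 * Real.exp (c ^ 2 / 2 * u i ^ 2) := by
    intro i
    have := Real.cosh_le_exp_half_sq (c * u i)
    rw [Real.cosh_eq] at this
    simp [boolSign]
    rw [show c ^ 2 / 2 * u i ^ 2 = (c * u i) ^ 2 / 2 by ring]
    linarith
  calc _ ≤ ∏ i, 2 * Real.exp (c ^ 2 / 2 * u i ^ 2) :=
        Finset.prod_le_prod (fun i _ => by positivity) fun i _ => h2 i
    _ = _ := by
      rw [Finset.prod_mul_distrib, ← Real.exp_sum, Finset.mul_sum]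
      simp

theorem integral_exp_neg_half_sq_add (c : ℝ) :
    Integrable (fun g : ℝ => Real.exp (-(1 / 2) * g ^ 2 + c * g)) ∧
    ∫ g : ℝ, Real.exp (-(1 / 2) * g ^ 2 + c * g) = √(2 * Real.pi) * Real.exp (c ^ 2 / 2) := by
  have h : (fun g : ℝ => Real.exp (-(1 / 2) * g ^ 2 + c * g))
      = fun g => Real.exp (-(1 / 2) * (g - c) ^ 2) * Real.exp (c ^ 2 / 2) := by
    funext g
    rw [← Real.exp_add]
    congr 1
    ring
  rw [h]
  refine ⟨((integrable_exp_neg_mul_sq (by norm_num : (0 : ℝ) < 1 / 2)).comp_sub_right c).mul_const _,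
    ?_⟩
  rw [integral_mul_const, integral_sub_right_eq_self (fun g : ℝ => Real.exp (-(1 / 2) * g ^ 2)) c,
    integral_gaussian]
  congr 2
  ring

/-- The square of a normalized Rademacher sum has the exponential moments of at most those of the
square of a standard Gaussian. -/
theorem sum_exp_signSum_sq_le {n : ℕ} (u : Fin n → ℝ) (hu : ∑ i, u i ^ 2 = 1) {θ : ℝ}
    (h0 : 0 ≤ θ) (h1 : θ < 1 / 2) :
    ∑ s, Real.exp (θ * signSum u s ^ 2) ≤ 2 ^ n * (√(1 - 2 * θ))⁻¹ := by
  have hpi := Real.pi_pos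
  have key : √(2 * Real.pi) * ∑ s, Real.exp (θ * signSum u s ^ 2)
      ≤ 2 ^ n * √(Real.pi / (1 / 2 - θ)) := by
    -- Linearize the square: `exp (θ X ^ 2)` is the mean of `exp (√(2θ) X g)` over a standard
    -- Gaussian `g`. After exchanging sum and integral, the sub-Gaussian bound applies for each
    -- fixed `g`.
    have e : ∀ s, √(2 * Real.pi) * Real.exp (θ * signSum u s ^ 2)
        = ∫ g : ℝ, Real.exp (-(1 / 2) * g ^ 2 + √(2 * θ) * signSum u s * g) := by
      intro s
      rw [(integral_exp_neg_half_sq_add _).2, mul_pow, Real.sq_sqrt (by linarith)]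
      congr 2
      ring
    rw [Finset.mul_sum, Finset.sum_congr rfl fun s _ => e s,
      ← integral_finsetSum _ fun s _ => (integral_exp_neg_half_sq_add _).1,
      ← integral_gaussian, ← integral_const_mul]
    refine integral_mono (integrable_finsetSum _ fun s _ => (integral_exp_neg_half_sq_add _).1)
      ((integrable_exp_neg_mul_sq (by linarith)).const_mul _) fun g => ?_
    have := sum_exp_signSum_le u (√(2 * θ) * g)
    rw [hu, mul_one, mul_pow, Real.sq_sqrt (by linarith)] at this
    calc ∑ s, Real.exp (-(1 / 2) * g ^ 2 + √(2 * θ) * signSum u s * g)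
        = Real.exp (-(1 / 2) * g ^ 2) * ∑ s, Real.exp (√(2 * θ) * g * signSum u s) := by
          rw [Finset.mul_sum]
          refine Finset.sum_congr rfl fun s _ => ?_
          rw [← Real.exp_add]
          congr 1
          ring
      _ ≤ Real.exp (-(1 / 2) * g ^ 2) * (2 ^ n * Real.exp (2 * θ * g ^ 2 / 2)) := by gcongr
      _ = 2 ^ n * Real.exp (-(1 / 2 - θ) * g ^ 2) := by
          rw [mul_left_comm, ← Real.exp_add]
          congr 2
          ring
  have e2 : √(Real.pi / (1 / 2 - θ)) = √(2 * Real.pi) * (√(1 - 2 * θ))⁻¹ := by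
    rw [← Real.sqrt_inv, ← Real.sqrt_mul (by positivity)]
    congr 1
    have : 1 / 2 - θ ≠ 0 := by linarith
    have : 1 - 2 * θ ≠ 0 := by linarith
    field_simp
  rw [e2, mul_left_comm] at key
  exact le_of_mul_le_mul_left key (by positivity)

/-- Follows from `exp y ≥ 1 + y + y ^ 2 / 2` and `(1 + y + y ^ 2 / 2) * (1 - y + y ^ 2 / 2) = 1 + y
^ 4 / 4 ≥ 1`. -/
theorem exp_neg_le_quadratic {y : ℝ} (hy : 0 ≤ y) : Real.exp (-y) ≤ 1 - y + y ^ 2 / 2 := by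
  have h := Real.quadratic_le_exp_of_nonneg hy
  rw [Real.exp_neg]
  refine inv_le_of_inv_le₀ (by nlinarith [sq_nonneg (y - 1)]) (le_trans ?_ h)
  rw [inv_le_iff_one_le_mul₀ (by nlinarith [sq_nonneg (y - 1)])]
  nlinarith [sq_nonneg (y ^ 2)]

theorem sum_exp_neg_signSum_sq_le {n : ℕ} (u : Fin n → ℝ) (hu : ∑ i, u i ^ 2 = 1) {θ : ℝ}
    (h0 : 0 ≤ θ) :
    ∑ s, Real.exp (-(θ * signSum u s ^ 2)) ≤ 2 ^ n * (1 - θ + 3 / 2 * θ ^ 2) := by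
  have h4 := sum_signSum_pow_four_le u
  have h2 := sum_signSum_sq u
  rw [hu] at h4 h2
  calc _ ≤ ∑ s, (1 - θ * signSum u s ^ 2 + (θ * signSum u s ^ 2) ^ 2 / 2) :=
        Finset.sum_le_sum fun s _ => exp_neg_le_quadratic (by positivity)
    _ = 2 ^ n - θ * ∑ s, signSum u s ^ 2 + θ ^ 2 / 2 * ∑ s, signSum u s ^ 4 := by
        rw [Finset.sum_add_distrib, Finset.sum_sub_distrib, Finset.mul_sum, Finset.mul_sum]
        simp
        refine Finset.sum_congr rfl fun s _ => by ring
    _ ≤ _ := by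
        rw [h2]
        nlinarith [mul_le_mul_of_nonneg_left h4 (by positivity : 0 ≤ θ ^ 2 / 2)]

/-! ### Numerical bounds for the moment functions -/

/-- The bound for the exponential moment of `X ^ 2 - 1`, `X` a normalized Rademacher sum. -/
noncomputable def upperMoment (θ : ℝ) : ℝ := Real.exp (-θ) * (√(1 - 2 * θ))⁻¹

/-- The bound for the exponential moment of `1 - X ^ 2`, `X` a normalized Rademacher sum. -/
noncomputable def lowerMoment (θ : ℝ) : ℝ := Real.exp θ * (1 - θ + 3 / 2 * θ ^ 2)

theorem upperMoment_le_exp {θ c : ℝ} (h1 : θ < 1 / 2)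
    (h : 1 ≤ (1 - 2 * θ) * Real.exp (2 * (θ + c * θ ^ 2))) :
    upperMoment θ ≤ Real.exp (c * θ ^ 2) := by
  have hp : 0 < 1 - 2 * θ := by linarith
  have h2 : 1 ≤ √(1 - 2 * θ) * Real.exp (θ + c * θ ^ 2) := by
    refine le_of_sq_le_sq ?_ (by positivity)
    rw [mul_pow, Real.sq_sqrt hp.le, ← Real.exp_nat_mul, one_pow]
    exact_mod_cast h
  rw [upperMoment, ← div_eq_mul_inv, div_le_iff₀ (by positivity)]
  rw [show c * θ ^ 2 = (θ + c * θ ^ 2) + -θ by ring, Real.exp_add]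
  nlinarith [Real.exp_pos (-θ)]

theorem quartic_le_exp {x : ℝ} (hx : 0 ≤ x) :
    1 + x + x ^ 2 / 2 + x ^ 3 / 6 + x ^ 4 / 24 ≤ Real.exp x := by
  have := Real.sum_le_exp_of_nonneg hx 5
  simp [Finset.sum_range_succ, Nat.factorial] at this
  linarith

/-- For `ε ≤ 2/3` one has `θ = 3/10 * ε * τ ≤ 1/5`. The constant is forced by the target exponent:
`3/10 - 1/6 = 40/27 * (3/10) ^ 2`. -/
theorem upperMoment_le_of_le_fifth {θ : ℝ} (h0 : 0 ≤ θ) (h1 : θ ≤ 1 / 5) :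
    upperMoment θ ≤ Real.exp (40 / 27 * θ ^ 2) := by
  refine upperMoment_le_exp (by linarith) ?_
  have hz := quartic_le_exp (x := 2 * (θ + 40 / 27 * θ ^ 2)) (by positivity)
  refine le_trans ?_ (mul_le_mul_of_nonneg_left hz (by linarith))
  have hk : ∀ k : ℕ, θ ^ k ≤ (1 / 5) ^ k := fun k => pow_le_pow_left₀ h0 h1 k
  -- The expanded product minus 1, with its `θ ^ 2` coefficient exact and the higher ones rounded
  -- down.
  have hQ : 0 ≤ θ ^ 2 * (26 / 27 - 3 * θ - 4 * θ ^ 2 - 10 * θ ^ 3 - 13 * θ ^ 4 - 18 * θ ^ 5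
      - 15 * θ ^ 6 - 7 * θ ^ 7) := by
    refine mul_nonneg (by positivity) ?_
    linarith [hk 2, hk 3, hk 4, hk 5, hk 6, hk 7]
  have h3 : ∀ k : ℕ, 0 ≤ θ ^ k := fun k => pow_nonneg h0 k
  linarith [h3 3, h3 4, h3 5, h3 6, h3 7, h3 8, h3 9]

theorem upperMoment_le {θ : ℝ} (h0 : 0 ≤ θ) (h1 : θ ≤ 3 / 10) :
    upperMoment θ ≤ Real.exp (43 / 24 * θ ^ 2) := by
  refine upperMoment_le_exp (by linarith) ?_
  have hz := quartic_le_exp (x := 2 * (θ + 43 / 24 * θ ^ 2)) (by positivity)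
  refine le_trans ?_ (mul_le_mul_of_nonneg_left hz (by linarith))
  have hk : ∀ k : ℕ, θ ^ k ≤ (3 / 10) ^ k := fun k => pow_le_pow_left₀ h0 h1 k
  have h3 : ∀ k : ℕ, 0 ≤ θ ^ k := fun k => pow_nonneg h0 k
  have hQ : 0 ≤ θ ^ 2 * (19 / 12 - 8 / 3 * θ - 275 / 100 * θ ^ 2 - 11 * θ ^ 3 - 148 / 10 * θ ^ 4
      - 26 * θ ^ 5 - 24 * θ ^ 6 - 14 * θ ^ 7) := by
    refine mul_nonneg (by positivity) ?_
    linarith [hk 2, hk 3, hk 4, hk 5, hk 6, hk 7]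
  linarith [h3 3, h3 4, h3 5, h3 6, h3 7, h3 8, h3 9]

theorem exp_le_quartic {θ : ℝ} (h0 : 0 ≤ θ) (h1 : θ ≤ 1) :
    Real.exp θ ≤ 1 + θ + θ ^ 2 / 2 + θ ^ 3 / 6 + 5 / 96 * θ ^ 4 := by
  have h := Real.exp_bound (x := θ) (by rwa [abs_of_nonneg h0]) (n := 4) (by norm_num)
  rw [abs_of_nonneg h0] at h
  have := (abs_le.mp h).2
  simp [Finset.sum_range_succ, Nat.factorial] at this
  linarith

theorem lowerMoment_le_quartic {θ : ℝ} (h0 : 0 ≤ θ) (h1 : θ ≤ 3 / 10) :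
    lowerMoment θ ≤ 1 + θ ^ 2 + 7 / 6 * θ ^ 3 + 3 / 4 * θ ^ 4 := by
  have h := mul_le_mul_of_nonneg_right (exp_le_quartic h0 (by linarith))
    (by nlinarith : 0 ≤ 1 - θ + 3 / 2 * θ ^ 2)
  refine h.trans ?_
  have h3 : ∀ k : ℕ, 0 ≤ θ ^ k := fun k => pow_nonneg h0 k
  have hk : 0 ≤ θ ^ 4 * (3 / 10 - θ) := mul_nonneg (h3 4) (by linarith)
  have hk2 : 0 ≤ θ ^ 5 * (3 / 10 - θ) := mul_nonneg (h3 5) (by linarith)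
  nlinarith [h3 4, h3 5, h3 6]

theorem lowerMoment_le {θ : ℝ} (h0 : 0 ≤ θ) (h1 : θ ≤ 3 / 10) :
    lowerMoment θ ≤ Real.exp (151 / 108 * θ ^ 2) := by
  have h3 : ∀ k : ℕ, 0 ≤ θ ^ k := fun k => pow_nonneg h0 k
  have hk : 0 ≤ θ ^ 2 * (3 / 10 - θ) := mul_nonneg (h3 2) (by linarith)
  have hk2 : 0 ≤ θ ^ 3 * (3 / 10 - θ) := mul_nonneg (h3 3) (by linarith)
  have := Real.quadratic_le_exp_of_nonneg (by positivity : 0 ≤ 151 / 108 * θ ^ 2)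
  nlinarith [lowerMoment_le_quartic h0 h1, h3 4]

/-- In the lower tail the negative eigenvalues, of total weight `p = (1 - τ) / 2`, contribute the
heavier upper moment. Since `τ ≥ 10/3 * θ` when `ε < 1`, this weight is small enough for the mixture
to obey the bound valid for the lower moment alone. -/
theorem mixed_moment_le {θ p : ℝ} (h0 : 0 ≤ θ) (h1 : θ ≤ 3 / 10) (hp0 : 0 ≤ p)
    (hp1 : p ≤ (1 - 10 / 3 * θ) / 2) :
    (1 - p) * lowerMoment θ + p * upperMoment θ ≤ Real.exp (151 / 108 * θ ^ 2) := by
  have h3 : ∀ k : ℕ, 0 ≤ θ ^ k := fun k => pow_nonneg h0 k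
  have hR := Real.quadratic_le_exp_of_nonneg (by positivity : 0 ≤ 151 / 108 * θ ^ 2)
  have hL := lowerMoment_le_quartic h0 h1
  have hU : upperMoment θ ≤ 1 + 43 / 24 * θ ^ 2 + 2 * θ ^ 4 := by
    refine (upperMoment_le h0 h1).trans ?_
    have hb : 43 / 24 * θ ^ 2 ≤ 43 / 24 * (3 / 10) ^ 2 := by gcongr
    have := exp_le_quartic (by positivity : 0 ≤ 43 / 24 * θ ^ 2) (by linarith)
    refine this.trans ?_
    have h6 : θ ^ 6 ≤ θ ^ 4 * (3 / 10) ^ 2 := by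
      rw [show θ ^ 6 = θ ^ 4 * θ ^ 2 by ring]
      gcongr
    have h8 : θ ^ 8 ≤ θ ^ 4 * (3 / 10) ^ 4 := by
      rw [show θ ^ 8 = θ ^ 4 * θ ^ 4 by ring]
      gcongr
    nlinarith [h3 4]
  -- The difference of the two polynomial bounds is nonnegative, so `p` may be replaced by its
  -- largest value.
  have hd : 0 ≤ 19 / 24 * θ ^ 2 - 7 / 6 * θ ^ 3 + 5 / 4 * θ ^ 4 := by
    have hk : 0 ≤ θ ^ 2 * (3 / 10 - θ) := mul_nonneg (h3 2) (by linarith)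
    nlinarith [h3 4, h3 2]
  have hp2 : p ≤ 1 := by linarith
  calc _ ≤ (1 - p) * (1 + θ ^ 2 + 7 / 6 * θ ^ 3 + 3 / 4 * θ ^ 4)
        + p * (1 + 43 / 24 * θ ^ 2 + 2 * θ ^ 4) := by gcongr
    _ = 1 + θ ^ 2 + 7 / 6 * θ ^ 3 + 3 / 4 * θ ^ 4
        + p * (19 / 24 * θ ^ 2 - 7 / 6 * θ ^ 3 + 5 / 4 * θ ^ 4) := by ring
    _ ≤ 1 + θ ^ 2 + 7 / 6 * θ ^ 3 + 3 / 4 * θ ^ 4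
        + (1 - 10 / 3 * θ) / 2 * (19 / 24 * θ ^ 2 - 7 / 6 * θ ^ 3 + 5 / 4 * θ ^ 4) := by gcongr
    _ ≤ _ := by
      refine le_trans ?_ hR
      -- The margin at order `θ ^ 2` is only `151/108 - (1 + 19/48) = 1/432`.
      have hq : 0 ≤ θ ^ 2 * (1 / 432 + 53 / 72 * θ - 235 / 100 * θ ^ 2 + 2 * θ ^ 3) := by
        refine mul_nonneg (h3 2) ?_
        nlinarith [h3 2, h3 3, mul_nonneg h0 (sub_nonneg.mpr h1),
          mul_nonneg (h3 2) (sub_nonneg.mpr h1)]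
      nlinarith [h3 4, h3 5]

/-! ### Tail exponents of the shrunken estimator -/

/-- The trace estimate is divided by this factor. For relative errors `ε` close to `1` the upper tail
of the unscaled estimator is heavier than `exp (-B (ε / ρ) ^ 2 / 6)`; shrinking the estimate trades
some of the slack in its lower tail for a lighter upper tail. -/
noncomputable def shrinkage (ε : ℝ) : ℝ := if ε ≤ 2 / 3 then 1 else 21 / 20

theorem convex_combination_le {p x y z : ℝ} (h0 : 0 ≤ p) (h1 : p ≤ 1) (hx : x ≤ z) (hy : y ≤ z) :
    (1 - p) * x + p * y ≤ z := by
  nlinarith [mul_le_mul_of_nonneg_left hx (sub_nonneg.mpr h1), mul_le_mul_of_nonneg_left hy h0]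

/-- Here `(1 ± τ) / 2` are the shares of positive and negative eigenvalues in `∑ |λ_i|`, and `τ *
((1 + ε) * shrinkage ε - 1)` is the deviation, in units of `∑ |λ_i|`, at which the scaled estimate
exceeds `(1 + ε)` times the trace. -/
theorem upper_tail_exponent {ε τ : ℝ} (hε0 : 0 < ε) (hε1 : ε < 1) (hτ0 : 0 < τ) (hτ1 : τ ≤ 1) :
    (1 + τ) / 2 * upperMoment (3 / 10 * (ε * τ)) + (1 - τ) / 2 * lowerMoment (3 / 10 * (ε * τ))
      ≤ Real.exp (3 / 10 * (ε * τ) * (τ * ((1 + ε) * shrinkage ε - 1)) - (ε * τ) ^ 2 / 6) := by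
  have hx0 : 0 < ε * τ := mul_pos hε0 hτ0
  have hxε : ε * τ ≤ ε := by nlinarith
  set θ := 3 / 10 * (ε * τ) with hθ
  have hL := lowerMoment_le (θ := θ) (by linarith) (by linarith)
  rw [show (1 + τ) / 2 = 1 - (1 - τ) / 2 by ring]
  unfold shrinkage
  split_ifs with h
  · rw [show θ * (τ * ((1 + ε) * 1 - 1)) - (ε * τ) ^ 2 / 6 = 40 / 27 * θ ^ 2 by rw [hθ]; ring]
    refine convex_combination_le (by linarith) (by linarith)
      (upperMoment_le_of_le_fifth (by linarith) (by linarith)) (hL.trans ?_)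
    exact Real.exp_le_exp.mpr (by nlinarith [sq_nonneg θ])
  · have hU := upperMoment_le (θ := θ) (by linarith) (by linarith)
    refine convex_combination_le (by linarith) (by linarith) (hU.trans ?_) (hL.trans ?_) <;>
    · refine Real.exp_le_exp.mpr ?_
      -- Shrinking raises the threshold: `21/20 * ε + 1/20 ≥ 11/10 * ε` because `ε < 1`. This
      -- accommodates the constant `43/24`.
      have h1 : 11 / 10 * (ε * τ) ≤ τ * ((1 + ε) * (21 / 20) - 1) := by nlinarith
      have h2 := mul_le_mul_of_nonneg_left h1 (by linarith : 0 ≤ θ)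
      rw [hθ] at h2 ⊢
      nlinarith [sq_nonneg (ε * τ)]

theorem lower_tail_exponent {ε τ : ℝ} (hε0 : 0 < ε) (hε1 : ε < 1) (hτ0 : 0 < τ) (hτ1 : τ ≤ 1) :
    (1 + τ) / 2 * lowerMoment (3 / 10 * (ε * τ)) + (1 - τ) / 2 * upperMoment (3 / 10 * (ε * τ))
      ≤ Real.exp (3 / 10 * (ε * τ) * (τ * (1 - (1 - ε) * shrinkage ε)) - (ε * τ) ^ 2 / 6) := by
  have hx0 : 0 < ε * τ := mul_pos hε0 hτ0
  have hxε : ε * τ ≤ ε := by nlinarith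
  set θ := 3 / 10 * (ε * τ) with hθ
  have hL := lowerMoment_le (θ := θ) (by linarith) (by linarith)
  rw [show (1 + τ) / 2 = 1 - (1 - τ) / 2 by ring]
  unfold shrinkage
  split_ifs with h
  · rw [show θ * (τ * (1 - (1 - ε) * 1)) - (ε * τ) ^ 2 / 6 = 40 / 27 * θ ^ 2 by rw [hθ]; ring]
    refine convex_combination_le (by linarith) (by linarith) (hL.trans ?_)
      (upperMoment_le_of_le_fifth (by linarith) (by linarith))
    exact Real.exp_le_exp.mpr (by nlinarith [sq_nonneg θ])
  · refine (mixed_moment_le (by linarith) (by linarith) (by linarith) (by nlinarith)).trans ?_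
    refine Real.exp_le_exp.mpr ?_
    -- The price of shrinking: `21/20 * ε - 1/20 ≥ 39/40 * ε` exactly when `ε ≥ 2/3`. The constant
    -- matches, as `3/10 * 39/40 - 1/6 = 151/108 * (3/10) ^ 2`.
    have h1 : 39 / 40 * (ε * τ) ≤ τ * (1 - (1 - ε) * (21 / 20)) := by nlinarith
    have h2 := mul_le_mul_of_nonneg_left h1 (by linarith : 0 ≤ θ)
    rw [hθ] at h2 ⊢
    nlinarith [sq_nonneg (ε * τ)]

/-! ### Concentration of the trace estimator -/

/-- The exponential moments of the normalized and centered quadratic form `∑ λ_i ⟪u_i, s⟫ ^ 2` in a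
random sign vector `s`, for unit vectors `u_i`. -/
theorem sum_exp_quadratic_form_le {n m : ℕ} (lam : Fin m → ℝ) (u : Fin m → Fin n → ℝ)
    (hu : ∀ i, ∑ j, u i j ^ 2 = 1) (hlam : 0 < ∑ i, |lam i|) {θ : ℝ} (h0 : 0 ≤ θ)
    (h1 : θ < 1 / 2) :
    ∑ s, Real.exp (θ * ((∑ i, lam i * signSum (u i) s ^ 2 - ∑ i, lam i) / ∑ i, |lam i|))
      ≤ 2 ^ n * ((1 + (∑ i, lam i) / ∑ i, |lam i|) / 2 * upperMoment θ
        + (1 - (∑ i, lam i) / ∑ i, |lam i|) / 2 * lowerMoment θ) := by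
  set L := ∑ i, |lam i| with hL
  have hU : ∀ i, ∑ s, Real.exp (θ * (signSum (u i) s ^ 2 - 1)) ≤ 2 ^ n * upperMoment θ := by
    intro i
    have := mul_le_mul_of_nonneg_right (sum_exp_signSum_sq_le (u i) (hu i) h0 h1)
      (Real.exp_pos (-θ)).le
    rw [Finset.sum_mul] at this
    simp_rw [← Real.exp_add] at this
    refine (Finset.sum_le_sum fun s _ => ?_).trans (this.trans_eq ?_)
    · exact (congrArg Real.exp (by ring)).le
    · rw [upperMoment]; ring
  have hD : ∀ i, ∑ s, Real.exp (-(θ * (signSum (u i) s ^ 2 - 1))) ≤ 2 ^ n * lowerMoment θ := by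
    intro i
    have := mul_le_mul_of_nonneg_right (sum_exp_neg_signSum_sq_le (u i) (hu i) h0)
      (Real.exp_pos θ).le
    rw [Finset.sum_mul] at this
    simp_rw [← Real.exp_add] at this
    refine (Finset.sum_le_sum fun s _ => ?_).trans (this.trans_eq ?_)
    · exact (congrArg Real.exp (by ring)).le
    · rw [lowerMoment]; ring
  have hi : ∀ i, ∑ s, |lam i| * Real.exp (θ * (SignType.sign (lam i) * (signSum (u i) s ^ 2 - 1)))
      ≤ 2 ^ n * ((|lam i| + lam i) / 2 * upperMoment θ + (|lam i| - lam i) / 2 * lowerMoment θ) := by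
    intro i
    rw [← Finset.mul_sum]
    rcases lt_trichotomy (lam i) 0 with h | h | h
    · have := mul_le_mul_of_nonneg_left (hD i) (neg_nonneg.mpr h.le)
      rw [abs_of_neg h]
      simp only [sign_neg h, SignType.coe_neg, SignType.coe_one, neg_mul,
        one_mul, mul_neg] at this ⊢
      linarith
    · simp [h]
    · have := mul_le_mul_of_nonneg_left (hU i) h.le
      rw [abs_of_pos h]
      simp only [sign_pos h, SignType.coe_one, one_mul]
      linarith
  have hJ : ∀ s, Real.exp (θ * ((∑ i, lam i * signSum (u i) s ^ 2 - ∑ i, lam i) / L))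
      ≤ (∑ i, |lam i| * Real.exp (θ * (SignType.sign (lam i) * (signSum (u i) s ^ 2 - 1)))) / L := by
    intro s
    -- Jensen with the probability weights `|lam i| / L`; the signs of the eigenvalues move into the
    -- exponent.
    have := convexOn_exp.map_sum_le (t := Finset.univ) (w := fun i => |lam i| / L)
      (p := fun i => θ * (SignType.sign (lam i) * (signSum (u i) s ^ 2 - 1)))
      (fun i _ => by positivity) (by rw [← Finset.sum_div, ← hL, div_self hlam.ne'])
      (fun i _ => Set.mem_univ _)
    simp only [smul_eq_mul] at this
    refine le_trans (le_of_eq ?_) (this.trans_eq ?_)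
    · congr 1
      rw [← Finset.sum_sub_distrib, Finset.sum_div, Finset.mul_sum]
      refine Finset.sum_congr rfl fun i _ => ?_
      conv_lhs => rw [← sign_mul_abs (lam i)]
      ring
    · rw [Finset.sum_div]
      exact Finset.sum_congr rfl fun i _ => by ring
  calc _ ≤ ∑ s, (∑ i, |lam i|
          * Real.exp (θ * (SignType.sign (lam i) * (signSum (u i) s ^ 2 - 1)))) / L :=
        Finset.sum_le_sum fun s _ => hJ s
    _ = (∑ i, ∑ s, |lam i|
          * Real.exp (θ * (SignType.sign (lam i) * (signSum (u i) s ^ 2 - 1)))) / L := by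
        rw [← Finset.sum_div, Finset.sum_comm]
    _ ≤ (∑ i, 2 ^ n * ((|lam i| + lam i) / 2 * upperMoment θ
          + (|lam i| - lam i) / 2 * lowerMoment θ)) / L := by
        gcongr with i
        exact hi i
    _ = _ := by
        rw [← Finset.mul_sum, Finset.sum_add_distrib, ← Finset.sum_mul, ← Finset.sum_mul,
          ← Finset.sum_div, ← Finset.sum_div, Finset.sum_add_distrib, Finset.sum_sub_distrib, ← hL]
        field_simp

open Classical in
/-- The Chernoff bound for `B` independent samples. -/
theorem chernoff_count {S : Type*} [Fintype S] (B : ℕ) (g : S → ℝ) {K : ℝ}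
    (hg : ∑ s, Real.exp (g s) ≤ K) :
    (((Finset.univ : Finset (Fin B → S)).filter fun s => 0 ≤ ∑ b, g (s b)).card : ℝ) ≤ K ^ B := by
  calc _ = ∑ s : Fin B → S, if 0 ≤ ∑ b, g (s b) then (1 : ℝ) else 0 := by
        rw [Finset.card_filter]; push_cast; rfl
    _ ≤ ∑ s : Fin B → S, ∏ b, Real.exp (g (s b)) := by
        refine Finset.sum_le_sum fun s _ => ?_
        -- The indicator of a nonnegative sum is at most the exponential of that sum, which factors
        -- over the samples.
        rw [← Real.exp_sum]
        split_ifs with h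
        · exact Real.one_le_exp h
        · positivity
    _ = (∑ s, Real.exp (g s)) ^ B := by
        rw [← Fintype.prod_sum fun (_ : Fin B) s => Real.exp (g s)]
        simp
    _ ≤ K ^ B := by gcongr

theorem quadratic_form_eq_sum_eigenvalues {n : ℕ} {C : Matrix (Fin n) (Fin n) ℝ}
    (hC : C.IsHermitian) (x : Fin n → ℝ) :
    x ⬝ᵥ C *ᵥ x = ∑ i, hC.eigenvalues i * (∑ j, hC.eigenvectorBasis i j * x j) ^ 2 := by
  have hent : ∀ j k, C j k
      = ∑ i, hC.eigenvalues i * (hC.eigenvectorBasis i j * hC.eigenvectorBasis i k) := by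
    intro j k
    conv_lhs => rw [hC.spectral_theorem, Unitary.conjStarAlgAut_apply]
    simp only [Matrix.mul_apply, Matrix.diagonal_apply, Matrix.star_apply,
      Matrix.IsHermitian.eigenvectorUnitary_apply, Function.comp_apply]
    simp
    exact Finset.sum_congr rfl fun i _ => by ring
  simp only [dotProduct, Matrix.mulVec, hent, pow_two, Finset.sum_mul, Finset.mul_sum]
  rw [Finset.sum_congr rfl fun j _ => Finset.sum_comm, Finset.sum_comm]
  refine Finset.sum_congr rfl fun i _ => ?_
  rw [Finset.sum_comm]
  refine Finset.sum_congr rfl fun j _ => Finset.sum_congr rfl fun k _ => by ring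

theorem sum_eigenvectorBasis_sq {n : ℕ} {C : Matrix (Fin n) (Fin n) ℝ}
    (hC : C.IsHermitian) (i : Fin n) : ∑ j, hC.eigenvectorBasis i j ^ 2 = 1 := by
  have h := hC.eigenvectorBasis.orthonormal.1 i
  rw [EuclideanSpace.norm_eq, Real.sqrt_eq_one] at h
  simpa using h

theorem sum_exp_upper_deviation_le {n m : ℕ} (lam : Fin m → ℝ) (u : Fin m → Fin n → ℝ)
    (hu : ∀ i, ∑ j, u i j ^ 2 = 1) {L t ε : ℝ} (hL : ∑ i, |lam i| = L) (ht : ∑ i, lam i = t)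
    (ht0 : 0 < t) (htL : t ≤ L) (hε0 : 0 < ε) (hε1 : ε < 1) :
    ∑ s, Real.exp (3 / 10 * (ε * (t / L)) * ((∑ i, lam i * signSum (u i) s ^ 2 - t) / L)
        - 3 / 10 * (ε * (t / L)) * (t / L * ((1 + ε) * shrinkage ε - 1)))
      ≤ 2 ^ n * Real.exp (-((ε * (t / L)) ^ 2 / 6)) := by
  have hL0 : 0 < L := ht0.trans_le htL
  have hτ0 : 0 < t / L := by positivity
  have hτ1 : t / L ≤ 1 := (div_le_one hL0).mpr htL
  have h1 := sum_exp_quadratic_form_le lam u hu (hL ▸ hL0) (θ := 3 / 10 * (ε * (t / L)))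
    (by positivity) (by nlinarith)
  rw [hL, ht] at h1
  have h2 := upper_tail_exponent hε0 hε1 hτ0 hτ1
  generalize t / L = τ at *
  generalize 3 / 10 * (ε * τ) = θ at *
  simp_rw [sub_eq_add_neg _ (θ * (τ * _)), Real.exp_add]
  rw [← Finset.sum_mul]
  refine (mul_le_mul_of_nonneg_right (h1.trans (mul_le_mul_of_nonneg_left h2 (by positivity)))
    (Real.exp_pos _).le).trans_eq ?_
  rw [mul_assoc, ← Real.exp_add]
  congr 2
  ring

theorem sum_exp_lower_deviation_le {n m : ℕ} (lam : Fin m → ℝ) (u : Fin m → Fin n → ℝ)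
    (hu : ∀ i, ∑ j, u i j ^ 2 = 1) {L t ε : ℝ} (hL : ∑ i, |lam i| = L) (ht : ∑ i, lam i = t)
    (ht0 : 0 < t) (htL : t ≤ L) (hε0 : 0 < ε) (hε1 : ε < 1) :
    ∑ s, Real.exp (-(3 / 10 * (ε * (t / L)) * ((∑ i, lam i * signSum (u i) s ^ 2 - t) / L))
        - 3 / 10 * (ε * (t / L)) * (t / L * (1 - (1 - ε) * shrinkage ε)))
      ≤ 2 ^ n * Real.exp (-((ε * (t / L)) ^ 2 / 6)) := by
  have hL0 : 0 < L := ht0.trans_le htL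
  have hτ0 : 0 < t / L := by positivity
  have hτ1 : t / L ≤ 1 := (div_le_one hL0).mpr htL
  -- Negating the eigenvalues turns the lower tail into an upper one and swaps the two moment
  -- functions.
  have h1 := sum_exp_quadratic_form_le (fun i => -lam i) u hu (by simpa [hL] using hL0)
    (θ := 3 / 10 * (ε * (t / L))) (by positivity) (by nlinarith)
  simp only [abs_neg, Finset.sum_neg_distrib, neg_mul, hL, ht] at h1
  have h2 := lower_tail_exponent hε0 hε1 hτ0 hτ1
  rw [neg_div, ← sub_eq_add_neg, sub_neg_eq_add, add_comm (_ * upperMoment _)] at h1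
  generalize t / L = τ at *
  generalize 3 / 10 * (ε * τ) = θ at *
  simp_rw [sub_eq_add_neg _ (θ * (τ * _)), Real.exp_add]
  rw [← Finset.sum_mul]
  refine (mul_le_mul_of_nonneg_right ((le_of_eq (Finset.sum_congr rfl fun s _ =>
    congrArg Real.exp ?_)).trans (h1.trans (mul_le_mul_of_nonneg_left h2 (by positivity))))
    (Real.exp_pos _).le).trans_eq ?_
  · ring
  · rw [mul_assoc, ← Real.exp_add]
    congr 2
    ring

theorem shrinkage_pos (ε : ℝ) : 0 < shrinkage ε := by
  unfold shrinkage
  split_ifs <;> norm_num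

open Classical in
/-- Concentration of the scaled mean of `B` quadratic forms in independent random sign vectors. -/
theorem card_mean_error_le {n m B : ℕ} (hB : 0 < B) (lam : Fin m → ℝ) (u : Fin m → Fin n → ℝ)
    (hu : ∀ i, ∑ j, u i j ^ 2 = 1) {L t ε : ℝ} (hL : ∑ i, |lam i| = L) (ht : ∑ i, lam i = t)
    (ht0 : 0 < t) (htL : t ≤ L) (hε0 : 0 < ε) (hε1 : ε < 1) :
    (((Finset.univ : Finset (Fin B → Fin n → Bool)).filter fun s =>
      ε * t < |(∑ b, ∑ i, lam i * signSum (u i) (s b) ^ 2) / (B * shrinkage ε) - t|).card : ℝ)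
      ≤ 2 * (2 ^ n * Real.exp (-((ε * (t / L)) ^ 2 / 6))) ^ B := by
  have hL0 : 0 < L := ht0.trans_le htL
  have hUp := sum_exp_upper_deviation_le lam u hu hL ht ht0 htL hε0 hε1
  have hLow := sum_exp_lower_deviation_le lam u hu hL ht ht0 htL hε0 hε1
  have hcU := chernoff_count B _ hUp
  have hcL := chernoff_count B _ hLow
  rw [two_mul]
  refine le_trans ?_ (add_le_add hcU hcL)
  rw [← Nat.cast_add]
  refine Nat.cast_le.mpr ((Finset.card_le_card fun s hs => ?_).trans (Finset.card_union_le _ _))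
  simp only [Finset.mem_filter, Finset.mem_univ, true_and, Finset.mem_union] at hs ⊢
  have hκ := shrinkage_pos ε
  have hB' : (0 : ℝ) < B := by exact_mod_cast hB
  clear hcU hcL hUp hLow
  generalize shrinkage ε = κ at *
  set Q : (Fin n → Bool) → ℝ := fun s => ∑ i, lam i * signSum (u i) s ^ 2
  have e1 : ∑ k, (3 / 10 * (ε * (t / L)) * ((Q (s k) - t) / L)
      - 3 / 10 * (ε * (t / L)) * (t / L * ((1 + ε) * κ - 1)))
      = 3 / 10 * (ε * (t / L)) / L * (∑ k, Q (s k) - B * (1 + ε) * κ * t) := by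
    simp only [Finset.sum_sub_distrib, ← Finset.mul_sum, ← Finset.sum_div, Finset.sum_const,
      Finset.card_univ, Fintype.card_fin, nsmul_eq_mul]
    ring
  have e2 : ∑ k, (-(3 / 10 * (ε * (t / L)) * ((Q (s k) - t) / L))
      - 3 / 10 * (ε * (t / L)) * (t / L * (1 - (1 - ε) * κ)))
      = 3 / 10 * (ε * (t / L)) / L * (B * (1 - ε) * κ * t - ∑ k, Q (s k)) := by
    simp only [Finset.sum_sub_distrib, Finset.sum_neg_distrib, ← Finset.mul_sum,
      ← Finset.sum_div, Finset.sum_const, Finset.card_univ, Fintype.card_fin, nsmul_eq_mul]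
    ring
  have hc : 0 ≤ 3 / 10 * (ε * (t / L)) / L := by positivity
  rw [e1, e2]
  rcases lt_abs.mp hs with h | h
  · left
    have h' : (1 + ε) * t < (∑ b, Q (s b)) / (B * κ) := by linarith
    rw [lt_div_iff₀ (by positivity)] at h'
    exact mul_nonneg hc (by linarith)
  · right
    have h' : (∑ b, Q (s b)) / (B * κ) < (1 - ε) * t := by linarith
    rw [div_lt_iff₀ (by positivity)] at h'
    exact mul_nonneg hc (by linarith)

open Classical in
/-- The scaled Rademacher trace estimator has relative error at most `ε`, except for a fraction
`2 exp (-B (ε / ρ) ^ 2 / 6)` of the sign vectors. -/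
theorem card_trace_estimate_error_le {n B : ℕ} (hB : 0 < B) {C : Matrix (Fin n) (Fin n) ℝ}
    (hC : C.IsHermitian) (ht : 0 < C.trace) {ε : ℝ} (hε0 : 0 < ε) (hε1 : ε < 1) :
    (((Finset.univ : Finset (Fin B → Fin n → Bool)).filter fun s =>
      ε * C.trace < |(∑ b, (fun v => boolSign (s b v)) ⬝ᵥ C *ᵥ fun v => boolSign (s b v))
        / (B * shrinkage ε) - C.trace|).card : ℝ)
      ≤ 2 * (2 ^ n * Real.exp (-((ε / RFP.rho hC) ^ 2 / 6))) ^ B := by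
  have htr : ∑ i, hC.eigenvalues i = C.trace := by
    rw [hC.trace_eq_sum_eigenvalues]; simp
  have htL : C.trace ≤ ∑ i, |hC.eigenvalues i| := by
    rw [← htr]; exact Finset.sum_le_sum fun i _ => le_abs_self _
  have h := card_mean_error_le hB hC.eigenvalues (fun i j => hC.eigenvectorBasis i j)
    (sum_eigenvectorBasis_sq hC) rfl htr ht htL hε0 hε1
  have hx : ε / RFP.rho hC = ε * (C.trace / ∑ i, |hC.eigenvalues i|) := by
    rw [RFP.rho, div_div_eq_mul_div, mul_div_assoc]
  rw [hx]
  simp_rw [quadratic_form_eq_sum_eigenvalues hC]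
  exact h

/-! ### Triangles and the trace of the cube -/

theorem card_filter_triple_eq_six {α : Type*} [Fintype α] [DecidableEq α] {s : Finset α}
    (hs : s.card = 3) :
    (Finset.univ.filter fun p : α × α × α => ({p.1, p.2.1, p.2.2} : Finset α) = s).card = 6 := by
  obtain ⟨a, b, c, hab, hac, hbc, rfl⟩ := Finset.card_eq_three.mp hs
  have : (Finset.univ.filter fun p : α × α × α =>
      ({p.1, p.2.1, p.2.2} : Finset α) = {a, b, c})
      = {(a, b, c), (a, c, b), (b, a, c), (b, c, a), (c, a, b), (c, b, a)} := by
    ext ⟨x, y, z⟩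
    simp only [Finset.mem_filter, Finset.mem_univ, true_and, Finset.mem_insert,
      Finset.mem_singleton, Prod.mk.injEq]
    constructor
    · intro h
      have hx : x ∈ ({a, b, c} : Finset α) := h ▸ by simp
      have hy : y ∈ ({a, b, c} : Finset α) := h ▸ by simp
      have hz : z ∈ ({a, b, c} : Finset α) := h ▸ by simp
      have ha : a ∈ ({x, y, z} : Finset α) := h ▸ by simp
      have hb : b ∈ ({x, y, z} : Finset α) := h ▸ by simp
      have hc : c ∈ ({x, y, z} : Finset α) := h ▸ by simp
      simp only [Finset.mem_insert, Finset.mem_singleton] at *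
      grind
    · rintro (⟨rfl, rfl, rfl⟩ | ⟨rfl, rfl, rfl⟩ | ⟨rfl, rfl, rfl⟩ | ⟨rfl, rfl, rfl⟩ |
        ⟨rfl, rfl, rfl⟩ | ⟨rfl, rfl, rfl⟩) <;> (ext w; simp; try tauto)
  rw [this]
  rw [Finset.card_insert_of_notMem, Finset.card_insert_of_notMem, Finset.card_insert_of_notMem,
    Finset.card_insert_of_notMem, Finset.card_insert_of_notMem, Finset.card_singleton] <;>
  simp <;> grind

/-- The trace counts closed walks of length 3, i.e. ordered triples of mutually adjacent vertices;
each triangle has six orderings. -/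
theorem trace_adjMatrix_cube {n : ℕ} (G : SimpleGraph (Fin n)) [DecidableRel G.Adj] :
    (G.adjMatrix ℝ ^ 3).trace = 6 * (RFP.triangleCount G : ℝ) := by
  have h1 : (G.adjMatrix ℝ ^ 3).trace
      = ((Finset.univ.filter fun p : Fin n × Fin n × Fin n =>
          G.Adj p.1 p.2.1 ∧ G.Adj p.1 p.2.2 ∧ G.Adj p.2.1 p.2.2).card : ℝ) := by
    rw [Finset.card_filter]
    push_cast
    simp only [Matrix.trace, Matrix.diag, pow_succ, pow_zero, one_mul, Matrix.mul_apply,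
      Fintype.sum_prod_type, Finset.sum_mul, SimpleGraph.adjMatrix_apply]
    refine Finset.sum_congr rfl fun i _ => ?_
    rw [Finset.sum_comm]
    refine Finset.sum_congr rfl fun j _ => Finset.sum_congr rfl fun k _ => ?_
    have := G.adj_comm i k
    split_ifs <;> simp <;> tauto
  rw [h1, RFP.triangleCount]
  have h2 := Finset.card_eq_sum_card_fiberwise
    (f := fun p : Fin n × Fin n × Fin n => ({p.1, p.2.1, p.2.2} : Finset (Fin n)))
    (s := Finset.univ.filter fun p : Fin n × Fin n × Fin n =>
          G.Adj p.1 p.2.1 ∧ G.Adj p.1 p.2.2 ∧ G.Adj p.2.1 p.2.2) (t := G.cliqueFinset 3)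
    (by
      rintro ⟨i, j, k⟩ h
      simp only [Finset.coe_filter, Finset.mem_univ, true_and, Set.mem_ofPred_eq] at h
      simp only [SetLike.mem_coe, SimpleGraph.mem_cliqueFinset_iff]
      exact SimpleGraph.is3Clique_triple_iff.mpr h)
  rw [h2]
  push_cast
  rw [Finset.sum_congr rfl (g := fun _ => (6 : ℝ)), Finset.sum_const, nsmul_eq_mul, mul_comm]
  intro s hs
  rw [SimpleGraph.mem_cliqueFinset_iff] at hs
  rw [Finset.filter_filter, ← Nat.cast_ofNat, ← card_filter_triple_eq_six hs.card_eq]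
  congr 2
  ext ⟨i, j, k⟩
  simp only [Finset.mem_filter, Finset.mem_univ, true_and, and_iff_right_iff_imp]
  rintro rfl
  exact SimpleGraph.is3Clique_triple_iff.mp hs

/-! ### Exact integer multiplication by ReLU units -/

/-- The coefficients of the piecewise linear interpolation of `z ^ 2` at the natural numbers in
terms of the functions `max (z - k) 0`. -/
def squareCoeff (k : ℕ) : ℝ := if k = 0 then 1 else 2

/-- From `m` to `m + 1` the units with threshold `k ≤ m` each grow by 1, and their coefficients `1,
2, …, 2` sum to `2 * m + 1`, the increment of the square. -/
theorem nat_sq_eq_sum_relu (m M : ℕ) (h : m ≤ M) :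
    (m : ℝ) ^ 2 = ∑ k : Fin (M + 1), squareCoeff k * max ((m : ℝ) - k) 0 := by
  rw [Fin.sum_univ_eq_sum_range fun k => squareCoeff k * max ((m : ℝ) - k) 0]
  induction m with
  | zero =>
    symm
    rw [Nat.cast_zero, zero_pow two_ne_zero]
    refine Finset.sum_eq_zero fun k _ => ?_
    rw [max_eq_right (by simp), mul_zero]
  | succ m ih =>
    have hstep : ∀ k ∈ Finset.range (M + 1),
        squareCoeff k * max (((m + 1 : ℕ) : ℝ) - k) 0
          = squareCoeff k * max ((m : ℝ) - k) 0 + if k ≤ m then squareCoeff k else 0 := by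
      intro k _
      split_ifs with hk
      · have : (k : ℝ) ≤ m := by exact_mod_cast hk
        rw [max_eq_left (by push_cast; linarith), max_eq_left (by linarith)]
        push_cast
        ring
      · have : (m : ℝ) + 1 ≤ k := by exact_mod_cast (by omega : m + 1 ≤ k)
        rw [max_eq_right (by push_cast; linarith), max_eq_right (by linarith)]
        ring
    rw [Finset.sum_congr rfl hstep, Finset.sum_add_distrib, ← ih (by omega), ← Finset.sum_filter,
      show (Finset.range (M + 1)).filter (· ≤ m) = Finset.range (m + 1) by
        ext k; simp only [Finset.mem_filter, Finset.mem_range]; omega,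
      Finset.sum_range_succ']
    simp [squareCoeff]
    ring

theorem int_sq_eq_sum_relu (z : ℤ) (M : ℕ) (h : |z| ≤ M) :
    (z : ℝ) ^ 2
      = ∑ σ : Bool, ∑ k : Fin (M + 1), squareCoeff k * max (boolSign σ * z - k) 0 := by
  have hneg : ∀ m : ℕ, ∑ k : Fin (M + 1), squareCoeff k * max (-(m : ℝ) - k) 0 = 0 := by
    intro m
    refine Finset.sum_eq_zero fun k _ => ?_
    rw [max_eq_right (by have : (0 : ℝ) ≤ m := by positivity
                         have : (0 : ℝ) ≤ (k : ℕ) := by positivity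
                         linarith), mul_zero]
  rw [Fintype.sum_bool]
  simp only [boolSign, if_true, Bool.false_eq_true, if_false, one_mul, neg_mul]
  obtain ⟨m, rfl | rfl⟩ := z.eq_nat_or_neg
  · simp only [Nat.abs_cast, Nat.cast_le] at h
    simp only [Int.cast_natCast]
    rw [hneg, add_zero, nat_sq_eq_sum_relu m M h]
  · simp only [abs_neg, Nat.abs_cast, Nat.cast_le] at h
    simp only [Int.cast_neg, Int.cast_natCast, neg_neg, neg_sq]
    rw [hneg, zero_add, nat_sq_eq_sum_relu m M h]

/-- The hidden units of a one-layer ReLU network that multiplies two integers: two signs and a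
threshold. -/
abbrev ProductUnit (M : ℕ) : Type := Bool × Bool × Fin (M + 1)

/-- The output weights of the network that multiplies two integers. -/
noncomputable def ProductUnit.coeff {M : ℕ} (q : ProductUnit M) : ℝ :=
  boolSign q.1 / 4 * squareCoeff q.2.2

/-- The activation of a hidden unit of the network that multiplies two integers. -/
noncomputable def ProductUnit.activation {M : ℕ} (q : ProductUnit M) (x y : ℝ) : ℝ :=
  max (boolSign q.2.1 * x + boolSign q.2.1 * boolSign q.1 * y - (q.2.2 : ℕ)) 0

/-- Polarization, `x * y = ((x + y) ^ 2 - (x - y) ^ 2) / 4`, with both squares written as ReLU sums.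
In a unit the first sign selects `x + y` or `x - y`, the second handles its positive or negative
part. -/
theorem int_mul_eq_sum_relu (x y : ℤ) (M : ℕ) (h : |x| + |y| ≤ M) :
    (x : ℝ) * y = ∑ q : ProductUnit M, q.coeff * q.activation x y := by
  have hp := int_sq_eq_sum_relu (x + y) M ((abs_add_le x y).trans h)
  have hm := int_sq_eq_sum_relu (x - y) M ((abs_sub x y).trans h)
  have e : ∀ τ : Bool, ∑ p : Bool × Fin (M + 1),
      ProductUnit.coeff (τ, p) * ProductUnit.activation (τ, p) x y
      = boolSign τ / 4 * ∑ σ : Bool, ∑ k : Fin (M + 1),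
        squareCoeff k * max (boolSign σ * (x + boolSign τ * y) - (k : ℕ)) 0 := by
    intro τ
    rw [Fintype.sum_prod_type, Finset.mul_sum]
    refine Finset.sum_congr rfl fun σ _ => ?_
    rw [Finset.mul_sum]
    refine Finset.sum_congr rfl fun k _ => ?_
    simp only [ProductUnit.coeff, ProductUnit.activation]
    rw [mul_assoc, show boolSign σ * (x : ℝ) + boolSign σ * boolSign τ * y - (k : ℕ)
      = boolSign σ * (x + boolSign τ * y) - (k : ℕ) by ring]
  rw [Fintype.sum_prod_type, Fintype.sum_bool, e, e]
  have h1 : (x : ℝ) + boolSign true * y = ((x + y : ℤ) : ℝ) := by simp [boolSign]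
  have h2 : (x : ℝ) + boolSign false * y = ((x - y : ℤ) : ℝ) := by
    simp [boolSign, sub_eq_add_neg]
  rw [h1, h2, ← hp, ← hm]
  simp only [boolSign, if_true, Bool.false_eq_true, if_false]
  push_cast
  ring

/-! ### Networks realizing the estimator -/

/-- There is one channel per trajectory and product unit. The embedding forms the signed
combinations of steps 1 and 2 and ignores the input features; a single layer with identity
self-weight and zero neighbour weight subtracts the thresholds in its bias and applies ReLU. The
output weights wait until the readout, since they commute with the sum over nodes. -/
theorem GraphConvWeights_exists_product (c B M : ℕ) {P : ℕ} (hP : 2 ≤ P) (scale : ℝ) :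
    ∃ W : RFP.GraphConvWeights c B P 1, ∀ {n : ℕ} (G : SimpleGraph (Fin n)) [DecidableRel G.Adj]
      (S : Matrix (Fin n) (Fin n) ℝ) (N : Matrix (Fin n) (Fin 1) ℝ → Matrix (Fin n) (Fin 1) ℝ)
      (w : ℕ) (f : Matrix (Fin n) (Fin c) ℝ) (r : Fin B → Matrix (Fin n) (Fin 1) ℝ),
      W.output G S N w f r = scale * ∑ b, ∑ v, ∑ q : ProductUnit M, q.coeff *
        q.activation (RFP.propagate S N w (r b) 1 v 0) (RFP.propagate S N w (r b) 2 v 0) := by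
  let e := (Fintype.equivFin (Fin B × ProductUnit M)).symm
  refine ⟨{
    embedDim := Fintype.card (Fin B × ProductUnit M)
    outDim := Fintype.card (Fin B × ProductUnit M)
    embed := Matrix.of fun i =>
      Pi.single (Sum.inr ((e i).1, ⟨1, by omega⟩, 0)) (boolSign (e i).2.2.1)
      + Pi.single (Sum.inr ((e i).1, ⟨2, by omega⟩, 0))
        (boolSign (e i).2.2.1 * boolSign (e i).2.1)
    stack := .cons 1 0 (fun i => -((e i).2.2.2 : ℕ)) (.nil _)
    readout := .linear (Matrix.of fun _ i => scale * (e i).2.coeff) 0 }, ?_⟩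
  intro n G _ S N w f r
  simp only [RFP.GraphConvWeights.output, RFP.MLP.eval, RFP.GraphConvStack.eval, add_zero,
    Matrix.one_mulVec, Matrix.zero_mulVec, Finset.sum_const_zero]
  have h := e.sum_comp fun p => scale * (p.2.coeff * ∑ v,
    p.2.activation (RFP.propagate S N w (r p.1) 1 v 0) (RFP.propagate S N w (r p.1) 2 v 0))
  rw [Fintype.sum_prod_type] at h
  simp only [Matrix.mulVec, dotProduct, Matrix.of_apply, Finset.sum_apply]
  refine (Finset.sum_congr rfl fun i _ => ?_).trans (h.trans ?_)
  · rw [mul_assoc]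
    congr 2
    refine Finset.sum_congr rfl fun v _ => ?_
    change max (((Pi.single _ _ + Pi.single _ _ :
      Fin c ⊕ (Fin B × Fin (P + 1) × Fin 1) → ℝ)) ⬝ᵥ _ + -_) 0 = _
    rw [add_dotProduct, single_dotProduct, single_dotProduct]
    rfl
  · rw [Finset.mul_sum]
    refine Finset.sum_congr rfl fun b _ => ?_
    rw [Finset.sum_comm, Finset.mul_sum]
    exact Finset.sum_congr rfl fun q _ => by rw [Finset.mul_sum]

/-- As for GraphConv, but each copy of the graph carries its own trajectory, so the channels are the
product units alone and the sum over the bag supplies the sum over `b`. -/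
theorem DSSWeights_exists_product (c M : ℕ) {P : ℕ} (hP : 2 ≤ P) (scale : ℝ) :
    ∃ W : RFP.DSSWeights c P 1, ∀ {n B : ℕ} (G : SimpleGraph (Fin n)) [DecidableRel G.Adj]
      (S : Matrix (Fin n) (Fin n) ℝ) (N : Matrix (Fin n) (Fin 1) ℝ → Matrix (Fin n) (Fin 1) ℝ)
      (w : ℕ) (f : Matrix (Fin n) (Fin c) ℝ) (r : Fin B → Matrix (Fin n) (Fin 1) ℝ),
      W.output G S N w f r = scale * ∑ b, ∑ v, ∑ q : ProductUnit M, q.coeff *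
        q.activation (RFP.propagate S N w (r b) 1 v 0) (RFP.propagate S N w (r b) 2 v 0) := by
  let e := (Fintype.equivFin (ProductUnit M)).symm
  refine ⟨{
    embedDim := Fintype.card (ProductUnit M)
    outDim := Fintype.card (ProductUnit M)
    subDim := 1
    embed := Matrix.of fun i =>
      Pi.single (Sum.inr (⟨1, by omega⟩, 0)) (boolSign (e i).2.1)
      + Pi.single (Sum.inr (⟨2, by omega⟩, 0)) (boolSign (e i).2.1 * boolSign (e i).1)
    stack := .cons 1 0 0 0 (fun i => -((e i).2.2 : ℕ)) (.nil _)
    subReadout := .linear (Matrix.of fun _ i => (e i).coeff) 0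
    readout := .linear (Matrix.of fun _ _ => scale) 0 }, ?_⟩
  intro n B G _ S N w f r
  simp only [RFP.DSSWeights.output, RFP.MLP.eval, RFP.DSSStack.eval, add_zero,
    Matrix.one_mulVec, Matrix.zero_mulVec]
  simp only [Matrix.mulVec, dotProduct, Matrix.of_apply, Finset.sum_apply,
    Finset.univ_unique, Finset.sum_singleton]
  congr 1
  refine Finset.sum_congr rfl fun b _ => ?_
  refine (Finset.sum_congr rfl fun i _ => ?_).trans ((e.sum_comp fun q => q.coeff * ∑ v,
    q.activation (RFP.propagate S N w (r b) 1 v 0) (RFP.propagate S N w (r b) 2 v 0)).trans ?_)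
  · congr 1
    refine Finset.sum_congr rfl fun v _ => ?_
    change max (((Pi.single _ _ + Pi.single _ _ :
      Fin c ⊕ (Fin (P + 1) × Fin 1) → ℝ)) ⬝ᵥ _ + -_) 0 = _
    rw [add_dotProduct, single_dotProduct, single_dotProduct]
    rfl
  · rw [Finset.sum_comm]
    exact Finset.sum_congr rfl fun q _ => by rw [Finset.mul_sum]

theorem propagate_one {n k : ℕ} (S : Matrix (Fin n) (Fin n) ℝ)
    (N : Matrix (Fin n) (Fin k) ℝ → Matrix (Fin n) (Fin k) ℝ) {w : ℕ} (hw : 3 ≤ w)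
    (r : Matrix (Fin n) (Fin k) ℝ) : RFP.propagate S N w r 1 = S * r := by
  simp [RFP.propagate, Nat.mod_eq_of_lt (by omega : 1 < w)]

theorem propagate_two {n k : ℕ} (S : Matrix (Fin n) (Fin n) ℝ)
    (N : Matrix (Fin n) (Fin k) ℝ → Matrix (Fin n) (Fin k) ℝ) {w : ℕ} (hw : 3 ≤ w)
    (r : Matrix (Fin n) (Fin k) ℝ) : RFP.propagate S N w r 2 = S * (S * r) := by
  simp [RFP.propagate, Nat.mod_eq_of_lt (by omega : 1 < w), Nat.mod_eq_of_lt (by omega : 2 < w)]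

theorem adjMatrix_mulVec_integer {n : ℕ} (G : SimpleGraph (Fin n)) [DecidableRel G.Adj]
    {y : Fin n → ℝ} {K : ℕ} (hy : ∀ v, ∃ z : ℤ, y v = z ∧ |z| ≤ K) (v : Fin n) :
    ∃ z : ℤ, (G.adjMatrix ℝ *ᵥ y) v = z ∧ |z| ≤ (n * K : ℕ) := by
  choose z hz hK using hy
  refine ⟨∑ u ∈ G.neighborFinset v, z u, ?_, ?_⟩
  · rw [SimpleGraph.adjMatrix_mulVec_apply]
    push_cast
    exact Finset.sum_congr rfl fun u _ => hz u
  · calc |∑ u ∈ G.neighborFinset v, z u| ≤ ∑ u ∈ G.neighborFinset v, |z u| :=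
          Finset.abs_sum_le_sum_abs _ _
      _ ≤ ∑ u, |z u| := Finset.sum_le_sum_of_subset_of_nonneg (Finset.subset_univ _)
          fun _ _ _ => abs_nonneg _
      _ ≤ ∑ _u : Fin n, (K : ℤ) := Finset.sum_le_sum fun u _ => hK u
      _ = _ := by simp

/-- On a sign vector, the hidden units compute the quadratic form of the cube of the adjacency
matrix exactly. -/
theorem sum_productUnit_eq_quadratic_form {n : ℕ} (G : SimpleGraph (Fin n)) [DecidableRel G.Adj]
    (N : Matrix (Fin n) (Fin 1) ℝ → Matrix (Fin n) (Fin 1) ℝ) {w : ℕ} (hw : 3 ≤ w)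
    (s : Fin n → Bool) (r : Matrix (Fin n) (Fin 1) ℝ) (hr : ∀ v, r v 0 = boolSign (s v)) :
    ∑ v, ∑ q : ProductUnit (n + n * n), q.coeff *
        q.activation (RFP.propagate (G.adjMatrix ℝ) N w r 1 v 0)
          (RFP.propagate (G.adjMatrix ℝ) N w r 2 v 0)
      = (fun v => boolSign (s v)) ⬝ᵥ (G.adjMatrix ℝ ^ 3) *ᵥ fun v => boolSign (s v) := by
  set x : Fin n → ℝ := fun v => boolSign (s v) with hx
  have hx0 : ∀ v, ∃ z : ℤ, x v = z ∧ |z| ≤ (1 : ℕ) := by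
    intro v
    cases h : s v
    · exact ⟨-1, by simp [hx, h, boolSign], by simp⟩
    · exact ⟨1, by simp [hx, h, boolSign], by simp⟩
  have h1 := adjMatrix_mulVec_integer G hx0
  have h2 := adjMatrix_mulVec_integer G h1
  have hrx : (fun v => r v 0) = x := funext hr
  have e1 : ∀ v, RFP.propagate (G.adjMatrix ℝ) N w r 1 v 0 = (G.adjMatrix ℝ *ᵥ x) v := by
    intro v
    rw [propagate_one _ _ hw, ← hrx]
    rfl
  have e2 : ∀ v, RFP.propagate (G.adjMatrix ℝ) N w r 2 v 0
      = (G.adjMatrix ℝ *ᵥ (G.adjMatrix ℝ *ᵥ x)) v := by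
    intro v
    rw [propagate_two _ _ hw, ← hrx]
    rfl
  have hsum : ∀ v, ∑ q : ProductUnit (n + n * n), q.coeff *
      q.activation (RFP.propagate (G.adjMatrix ℝ) N w r 1 v 0)
        (RFP.propagate (G.adjMatrix ℝ) N w r 2 v 0)
      = (G.adjMatrix ℝ *ᵥ x) v * (G.adjMatrix ℝ *ᵥ (G.adjMatrix ℝ *ᵥ x)) v := by
    intro v
    obtain ⟨z1, hz1, hb1⟩ := h1 v
    obtain ⟨z2, hz2, hb2⟩ := h2 v
    rw [e1, e2, hz1, hz2, ← int_mul_eq_sum_relu z1 z2]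
    push_cast at hb1 hb2 ⊢
    linarith
  rw [Finset.sum_congr rfl fun v _ => hsum v]
  change (G.adjMatrix ℝ *ᵥ x) ⬝ᵥ (G.adjMatrix ℝ *ᵥ (G.adjMatrix ℝ *ᵥ x)) = _
  -- Symmetry moves one factor `A` across the inner product, so two propagation steps reach the
  -- cube.
  have hsymm : G.adjMatrix ℝ *ᵥ x = x ᵥ* G.adjMatrix ℝ := by
    rw [← Matrix.vecMul_transpose, SimpleGraph.transpose_adjMatrix]
  conv_lhs => arg 1; rw [hsymm]
  rw [← Matrix.dotProduct_mulVec, Matrix.mulVec_mulVec, Matrix.mulVec_mulVec]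
  congr 2
  rw [pow_succ, pow_two]

/-! ### From the tail bound to the approximation guarantee -/

/-- A positive trace forces a nonzero eigenvalue, hence rank at least 1, so `log (2 * rank / δ)`
dominates the `log (2 / δ)` that the two-sided tail requires. -/
theorem two_mul_exp_le_of_bound {n : ℕ} {C : Matrix (Fin n) (Fin n) ℝ} (hC : C.IsHermitian)
    (ht : 0 < C.trace) {ε δ B : ℝ} (hε : 0 < ε) (hδ : 0 < δ)
    (h : 6 * (ε ^ 2)⁻¹ * RFP.rho hC ^ 2 * Real.log (2 * (C.rank : ℝ) / δ) ≤ B) :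
    2 * Real.exp (-(B * ((ε / RFP.rho hC) ^ 2 / 6))) ≤ δ := by
  have hρ : 0 < RFP.rho hC := by
    have htr : ∑ i, hC.eigenvalues i = C.trace := by
      rw [hC.trace_eq_sum_eigenvalues]; simp
    refine div_pos (ht.trans_le ?_) ht
    rw [← htr]
    exact Finset.sum_le_sum fun i _ => le_abs_self _
  have hR : (1 : ℝ) ≤ C.rank := by
    have : C.rank ≠ 0 := by
      intro h0
      rw [hC.rank_eq_card_non_zero_eigs, Fintype.card_eq_zero_iff, isEmpty_subtype] at h0
      rw [hC.trace_eq_sum_eigenvalues] at ht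
      simp only [not_not] at h0
      simp [h0] at ht
    exact_mod_cast Nat.one_le_iff_ne_zero.mpr this
  have hlog : Real.log (2 * (C.rank : ℝ) / δ) ≤ B * ((ε / RFP.rho hC) ^ 2 / 6) := by
    have := mul_le_mul_of_nonneg_right h (by positivity : 0 ≤ (ε / RFP.rho hC) ^ 2 / 6)
    refine le_trans (le_of_eq ?_) this
    field_simp
  rw [Real.log_le_iff_le_exp (by positivity), div_le_iff₀ hδ] at hlog
  rw [Real.exp_neg, ← div_eq_mul_inv, div_le_iff₀ (Real.exp_pos _)]
  linarith

theorem one_sub_le_initLaw_real {B n k : ℕ} {S : Set (Fin B × Fin n × Fin k → ℝ)}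
    {T : Set (Fin B × Fin n × Fin k → Bool)} {p : ℝ} [DecidablePred (· ∈ T)]
    (h : ∀ s, (fun i => boolSign (s i)) ∉ S → s ∈ T)
    (hT : ((Finset.univ.filter (· ∈ T)).card : ℝ) ≤ 2 ^ Fintype.card (Fin B × Fin n × Fin k) * p) :
    1 - p ≤ (RFP.initLaw B n k).real S := by
  classical
  rw [initLaw_real, ← Finset.mul_sum]
  have h1 : ∀ s : Fin B × Fin n × Fin k → Bool,
      (1 : ℝ) - (if s ∈ T then 1 else 0) ≤ if (fun i => boolSign (s i)) ∈ S then 1 else 0 := by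
    intro s
    have := h s
    split_ifs <;> first | (norm_num; done) | tauto
  have h2 := Finset.sum_le_sum fun s (_ : s ∈ Finset.univ) => h1 s
  rw [Finset.sum_sub_distrib, Finset.sum_boole (p := fun s => s ∈ T)] at h2
  simp only [Finset.sum_const, Finset.card_univ, Fintype.card_fun, Fintype.card_bool, nsmul_eq_mul,
    mul_one, Nat.cast_pow, Nat.cast_ofNat] at h2
  refine le_trans ?_ (mul_le_mul_of_nonneg_left h2 (by positivity))
  rw [one_div, inv_pow, ← div_eq_inv_mul, le_div_iff₀ (by positivity)]
  linarith

/-- A function of the random features that agrees with the scaled trace estimator on sign vectors is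
an `(ε, δ)` relative approximation of the triangle count. -/
theorem triangleCount_approximation {n B : ℕ} (G : SimpleGraph (Fin n)) [DecidableRel G.Adj]
    {ε δ : ℝ} (hε0 : 0 < ε) (hε1 : ε < 1) (hδ : 0 < δ) (hG : 0 < RFP.triangleCount G)
    (hbound : RFP.trajectoryBound G ε δ ≤ (B : ℝ))
    (F : (Fin B → Matrix (Fin n) (Fin 1) ℝ) → ℝ)
    (hF : ∀ s : Fin B × Fin n × Fin 1 → Bool, F (RFP.features fun i => boolSign (s i))
      = (6 * (B * shrinkage ε))⁻¹ * ∑ b, (fun v => boolSign (s (b, v, 0))) ⬝ᵥ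
          (G.adjMatrix ℝ ^ 3) *ᵥ fun v => boolSign (s (b, v, 0))) :
    1 - δ ≤ (RFP.initLaw B n 1).real {ω | |F (RFP.features ω) - (RFP.triangleCount G : ℝ)|
      ≤ ε * (RFP.triangleCount G : ℝ)} := by
  classical
  have htr := trace_adjMatrix_cube G
  have ht : 0 < (G.adjMatrix ℝ ^ 3).trace := by
    rw [htr]
    have : (0 : ℝ) < RFP.triangleCount G := by exact_mod_cast hG
    positivity
  have hδ' := two_mul_exp_le_of_bound (RFP.isHermitian_adjMatrix_cube G) ht hε0 hδ hbound
  -- With no trajectories the hypothesis already gives `2 ≤ δ`, and the claim is void.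
  rcases Nat.eq_zero_or_pos B with rfl | hB
  · simp only [Nat.cast_zero, zero_mul, neg_zero, Real.exp_zero, mul_one] at hδ'
    exact le_trans (by linarith) MeasureTheory.measureReal_nonneg
  refine le_trans (sub_le_sub_left hδ' 1) ?_
  have hcard := card_trace_estimate_error_le hB (RFP.isHermitian_adjMatrix_cube G) ht hε0 hε1
  refine one_sub_le_initLaw_real (T := {s | ε * (G.adjMatrix ℝ ^ 3).trace <
    |(∑ b, (fun v => boolSign (s (b, v, 0))) ⬝ᵥ (G.adjMatrix ℝ ^ 3) *ᵥ
      fun v => boolSign (s (b, v, 0))) / (B * shrinkage ε) - (G.adjMatrix ℝ ^ 3).trace|}) ?_ ?_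
  · intro s hs
    simp only [Set.mem_ofPred_eq, not_le] at hs ⊢
    rw [hF] at hs
    rw [htr]
    have e : ∀ X D : ℝ, X / D - 6 * (RFP.triangleCount G : ℝ)
        = 6 * ((6 * D)⁻¹ * X - RFP.triangleCount G) := by
      intro X D
      rw [mul_inv]
      ring
    rw [e, abs_mul, abs_of_pos (by norm_num : (0 : ℝ) < 6)]
    linarith
  · refine le_trans ?_ (hcard.trans_eq ?_)
    · refine Nat.cast_le.mpr (Finset.card_le_card_of_injOn (fun s b v => s (b, v, 0)) ?_ ?_)
      · intro s hs
        simpa using hs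
      · intro s _ s' _ h
        funext ⟨b, v, i⟩
        rw [Subsingleton.elim i 0]
        exact congrFun (congrFun h b) v
    · rw [mul_pow, ← pow_mul, ← Real.exp_nat_mul]
      simp only [Fintype.card_prod, Fintype.card_fin, mul_one]
      rw [mul_comm n B, mul_left_comm]
      congr 3
      ring

theorem mainTheorem3 (ε δ : ℝ) (hε : 0 < ε) (hδ : 0 < δ) (n c B P w : ℕ)
    (hP : 2 ≤ P) (hw : 3 ≤ w)
    (N : Matrix (Fin n) (Fin 1) ℝ → Matrix (Fin n) (Fin 1) ℝ) :
    (∃ W : RFP.GraphConvWeights c B P 1,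
      ∀ (G : SimpleGraph (Fin n)) [DecidableRel G.Adj] (fin : Matrix (Fin n) (Fin c) ℝ),
        0 < RFP.triangleCount G → RFP.trajectoryBound G ε δ ≤ (B : ℝ) →
        1 - δ ≤ (RFP.initLaw B n 1).real
          {ω | |W.output G (G.adjMatrix ℝ) N w fin (RFP.features ω) - (RFP.triangleCount G : ℝ)|
            ≤ ε * (RFP.triangleCount G : ℝ)}) ∧
    (∃ W : RFP.DSSWeights c P 1,
      ∀ (G : SimpleGraph (Fin n)) [DecidableRel G.Adj] (fin : Matrix (Fin n) (Fin c) ℝ),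
        0 < RFP.triangleCount G → RFP.trajectoryBound G ε δ ≤ (B : ℝ) →
        1 - δ ≤ (RFP.initLaw B n 1).real
          {ω | |W.output G (G.adjMatrix ℝ) N w fin (RFP.features ω) - (RFP.triangleCount G : ℝ)|
            ≤ ε * (RFP.triangleCount G : ℝ)}) := by
  rcases lt_or_ge ε 1 with hε1 | hε1
  · obtain ⟨W₁, hW₁⟩ := GraphConvWeights_exists_product c B (n + n * n) hP
      (6 * (B * shrinkage ε))⁻¹
    obtain ⟨W₂, hW₂⟩ := DSSWeights_exists_product c (n + n * n) hP (6 * (B * shrinkage ε))⁻¹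
    refine ⟨⟨W₁, fun G _ fin hG hbound => triangleCount_approximation G hε hε1 hδ hG hbound
      (W₁.output G (G.adjMatrix ℝ) N w fin) fun s => ?_⟩,
      ⟨W₂, fun G _ fin hG hbound => triangleCount_approximation G hε hε1 hδ hG hbound
      (W₂.output G (G.adjMatrix ℝ) N w fin) fun s => ?_⟩⟩
    · rw [hW₁]
      congr 1
      exact Finset.sum_congr rfl fun b _ =>
        sum_productUnit_eq_quadratic_form G N hw (fun v => s (b, v, 0)) _ fun v => rfl
    · rw [hW₂]
      congr 1
      exact Finset.sum_congr rfl fun b _ =>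
        sum_productUnit_eq_quadratic_form G N hw (fun v => s (b, v, 0)) _ fun v => rfl
  · -- For `ε ≥ 1` the trace estimator can fail, but the constant `0` has relative error `1`.
    have htriv : ∀ (G : SimpleGraph (Fin n)) [DecidableRel G.Adj]
        (F : (Fin B × Fin n × Fin 1 → ℝ) → ℝ),
        (∀ ω, F ω = 0) → 1 - δ ≤ (RFP.initLaw B n 1).real
          {ω | |F ω - (RFP.triangleCount G : ℝ)| ≤ ε * (RFP.triangleCount G : ℝ)} := by
      intro G _ F hF
      refine one_sub_le_initLaw_real (T := ∅) (fun s hs => hs ?_) (by simp; positivity)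
      simp only [Set.mem_ofPred_eq, hF, zero_sub, abs_neg, Nat.abs_cast]
      exact le_mul_of_one_le_left (Nat.cast_nonneg _) hε1
    refine ⟨?_, ?_⟩
    -- Scale `0` makes the network output identically zero.
    · obtain ⟨W, hW⟩ := GraphConvWeights_exists_product c B 0 hP 0
      exact ⟨W, fun G _ fin _ _ => htriv G _ fun ω => by rw [hW, zero_mul]⟩
    · obtain ⟨W, hW⟩ := DSSWeights_exists_product c 0 hP 0
      exact ⟨W, fun G _ fin _ _ => htriv G _ fun ω => by rw [hW, zero_mul]⟩
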